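/- Let $d\ge 1$ (number of features) and $p\ge 0$ (maximal lag). For every feature $j\in\{1,\dots,d\}$ let $\mathsf{pa}(j)\subseteq\{0,\dots,p\}\times\{1,\dots,d\}$ be its parent set, where $(k,i)\in\mathsf{pa}(j)$ means that feature $i$ at time $t-k$ is a parent of feature $j$ at time $t$; the same-time graph ($i\to j$ iff $(0,i)\in\mathsf{pa}(j)$) is acyclic. Let $X^{(1)},X^{(2)},\dots,X^{(T)}$ be an $\mathbb R^d$-valued process with arbitrary initial snapshots $X^{(1)},\dots,X^{(p)}$ such that, for all $t\in\{p+1,\dots,T\}$ and all $j$, almost surely $$X^{(t)}_j=f_j\Big(\big(X^{(t-k)}_i\big)_{(k,i)\in\mathsf{pa}(j)}\Big)+z^{(t)}_j ,$$ where $z^{(t)}_j\sim\mathcal N(0,\sigma_j^2)$ with $\sigma_j^2>0$, the variables $z^{(t)}_1,\dots,z^{(t)}_d$ are mutually independent, and $z^{(t)}=(z^{(t)}_1,\dots,z^{(t)}_d)$ is independent of $(X^{(1)},\dots,X^{(t-1)})$. Assume that every link function $f_j$ is $C^\infty$ and that, for every parent in $\mathsf{pa}(j)$, the partial derivative of $f_j$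 with respect to that parent is not identically zero. Fix $t\in\{p+1,\dots,T\}$ and let $\bar X^{(t)}=(X^{(t)},X^{(t-1)},\dots,X^{(t-p)})$. Assume that $\bar X^{(t)}$ has an everywhere positive and differentiable probability density $\mathsf f^{(t)}$ on $\mathbb R^{(p+1)d}$. Let $l$ be a leaf at time $t$, i.e. $(0,l)\notin\mathsf{pa}(j)$ for all $j$. Let $\bar X^{(t)}_{\setminus\{l\}}$ be the vector $\bar X^{(t)}$ without the coordinate $X^{(t)}_l$, and let $\mathsf f^{(t)}_{\setminus\{l\}}$ be its density, obtained by integrating $\mathsf f^{(t)}$ over $x^{(t)}_l\in\mathbb R$. For a feature $j$ and a time $t'\in\{t,t-1,\dots,t-p\}$ with $(j,t')\ne(l,t)$ define the partial scores $$\mathsf s^{(t)}_{j,t'}(\bar x^{(t)})=\frac{\partial\log\mathsf f^{(t)}}{\partial x^{(t')}_j}(\bar x^{(t)}),\qquad \mathsf s^{(t)}_{j,t'}(\bar x^{(t)}_{\setminus\{l\}})=\frac{\partial\log\mathsf f^{(t)}_{\setminus\{l\}}}{\partial x^{(t')}_j}(\bar x^{(t)}_{\setminus\{l\}}),$$ and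 assume that the variance of $\mathsf s^{(t)}_{j,t'}(\bar X^{(t)}_{\setminus\{l\}})$ is finite. Then feature $j$ at time $t'$ is a parent of feature $l$ at time $t$, i.e. $(t-t',j)\in\mathsf{pa}(l)$, if and only if $$\mathrm{Var}\big(\mathsf s^{(t)}_{j,t'}(\bar X^{(t)})\big)>\mathrm{Var}\big(\mathsf s^{(t)}_{j,t'}(\bar X^{(t)}_{\setminus\{l\}})\big),$$ where the variance on the left is taken to be $+\infty$ if the score is not square-integrable. -/

import Mathlib

open MeasureTheory ProbabilityTheory
open scoped NNReal ENNReal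

noncomputable section

/-- The partial derivative `∂F/∂x_c` at `x` of a real function of the variables `x = (x_i)_{i ∈ ι}`. -/
def partialDeriv {ι : Type*} [DecidableEq ι] (F : (ι → ℝ) → ℝ) (c : ι) (x : ι → ℝ) : ℝ :=
  deriv (fun u : ℝ => F (Function.update x c u)) (x c)

/-- The partial score `∂ log g / ∂x_c` of a density `g`. -/
def partialScore {ι : Type*} [DecidableEq ι] (g : (ι → ℝ) → ℝ) (c : ι) (x : ι → ℝ) : ℝ :=
  partialDeriv (fun y => Real.log (g y)) c x

/-- The vector indexed by `ι` whose coordinate `a` is `u` and whose other coordinates are those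
of `y`. -/
def insertCoord {ι : Type*} [DecidableEq ι] (a : ι) (u : ℝ) (y : {c : ι // c ≠ a} → ℝ) : ι → ℝ :=
  fun c => if h : c = a then u else y ⟨c, h⟩

/-- The density of the remaining variables after the variable `a` has been marginalised out. -/
def marginalDensity {ι : Type*} [DecidableEq ι] (g : (ι → ℝ) → ℝ) (a : ι)
    (y : {c : ι // c ≠ a} → ℝ) : ℝ :=
  ∫ u : ℝ, g (insertCoord a u y)

/-- Nodes of the time-unrolled graph seen from the present time: `(k, i)` is the feature `i` at
lag `k ∈ {0, …, p}`, that is, at time `t - k`. -/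
abbrev LagNode (d p : ℕ) : Type := Fin (p + 1) × Fin d

/-- A structural vector autoregressive model with `d` features, maximal lag `p`, additive
Gaussian noise, and link functions that do not change in time. -/
structure SVARModel (d p : ℕ) where
  /-- `(k, i) ∈ pa j` says that feature `i` at time `t - k` is a parent of feature `j` at
  time `t`: the pairs with `k = 0` form the intra-snapshot graph, those with `k ≥ 1` the
  inter-snapshot graphs. -/
  pa : Fin d → Finset (LagNode d p)
  /-- The intra-snapshot graph has no directed cycle. -/
  acyclic : ∀ i, ¬ Relation.TransGen (fun i j : Fin d => ((0, i) : LagNode d p) ∈ pa j) i i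
  /-- The link function of feature `j`, a function of the values of the parents of `j`. -/
  link : (j : Fin d) → ((pa j → ℝ) → ℝ)
  /-- The variance of the noise of feature `j`. -/
  noiseVar : Fin d → ℝ≥0
  noiseVar_pos : ∀ j, 0 < noiseVar j

namespace SVARModel

variable {d p : ℕ}

/-- `l` is a leaf: at the same time step it is not a parent of any feature. -/
def IsLeaf (M : SVARModel d p) (l : Fin d) : Prop :=
  ∀ j, ((0, l) : LagNode d p) ∉ M.pa j

/-- Every link function is smooth, and none of its partial derivatives with respect to a parent
vanishes identically. -/
structure RegularLinks (M : SVARModel d p) : Prop where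
  smooth : ∀ j, ContDiff ℝ (⊤ : ℕ∞) (M.link j)
  partialDeriv_ne_zero : ∀ j, ∀ c : M.pa j, ∃ x, partialDeriv (M.link j) c x ≠ 0

/-- The process `X^{(1)}, …, X^{(T)}` is generated by the model `M` with the noise variables
`z`. The first `p` snapshots are arbitrary; at each time `s ∈ {p + 1, …, T}` every feature is its
link function evaluated at its parents, plus Gaussian noise that is independent across the features
and independent of all earlier snapshots. -/
structure Generates {Ω : Type*} [MeasurableSpace Ω] (M : SVARModel d p) (T : ℕ) (μ : Measure Ω)
    (X z : ℕ → Fin d → Ω → ℝ) : Prop where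
  measurable_process : ∀ s ∈ Set.Icc 1 T, ∀ j, Measurable (X s j)
  measurable_noise : ∀ s ∈ Set.Ioc p T, ∀ j, Measurable (z s j)
  noise_law : ∀ s ∈ Set.Ioc p T, ∀ j, μ.map (z s j) = gaussianReal 0 (M.noiseVar j)
  noise_indep : ∀ s ∈ Set.Ioc p T, iIndepFun (z s) μ
  noise_indep_past : ∀ s ∈ Set.Ioc p T,
    IndepFun (fun ω (j : Fin d) => z s j ω)
      (fun ω (r : Set.Ico 1 s) (i : Fin d) => X (r : ℕ) i ω) μ
  equation : ∀ s ∈ Set.Ioc p T, ∀ᵐ ω ∂μ, ∀ j,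
    X s j ω =
      M.link j (fun c : M.pa j => X (s - ((c : LagNode d p).1 : ℕ)) (c : LagNode d p).2 ω)
        + z s j ω

end SVARModel

/-- The vector `(X^{(t)}, …, X^{(t-p)})`. -/
def stackedVector {Ω : Type*} {d : ℕ} (p : ℕ) (X : ℕ → Fin d → Ω → ℝ) (t : ℕ) (ω : Ω) :
    LagNode d p → ℝ :=
  fun c => X (t - (c.1 : ℕ)) c.2 ω

/-- The vector `(X^{(t)}, …, X^{(t-p)})` without the coordinate `X_l^{(t)}`. -/
def stackedVectorWithout {Ω : Type*} {d : ℕ} (p : ℕ) (X : ℕ → Fin d → Ω → ℝ) (t : ℕ) (l : Fin d)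
    (ω : Ω) : {c : LagNode d p // c ≠ (0, l)} → ℝ :=
  fun c => stackedVector p X t ω c

end

/-! ### Splitting off one coordinate -/

section Coordinates

variable {ι : Type*} [DecidableEq ι] {a : ι}

/-! Let `Y` be all coordinates except the leaf `l` at time `t`. By acyclicity, and because `l` feeds
no feature at time `t`, `Y` is a function of the other noises and the past, so `z t l` is
independent of `Y` (`Generates.indepFun_noise_stackedVectorWithout`). Hence the leaf is `h(Y) + z`,
and the density factors as the marginal at `y` times a Gaussian in `u` centred at `h(y)`
(`eq_mul_gaussianPDFReal_of_indepFun`).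

The logarithmic derivative in `c` turns this into: full score = marginal score + `z * ∂_c h(Y) /
σ²`. If `c` is not a parent, the extra term vanishes and the variances agree. If it is, the extra
term is centred given `Y` and adds `E[(∂_c h(Y))²] / σ²`, possibly infinite. This is positive
because `∂_c h` is nonzero on a nonempty open set, which the positive density charges; finiteness of
the marginal variance makes the inequality strict. -/

@[simp] theorem insertCoord_self (u : ℝ) (y : {c : ι // c ≠ a} → ℝ) :
    insertCoord a u y a = u := by simp [insertCoord]

@[simp] theorem insertCoord_coe (u : ℝ) (y : {c : ι // c ≠ a} → ℝ) (c : {c : ι // c ≠ a}) :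
    insertCoord a u y c = y c := by simp [insertCoord, c.2]

theorem differentiableAt_insertCoord [Fintype ι] (u : ℝ) (y : {c : ι // c ≠ a} → ℝ) :
    DifferentiableAt ℝ (fun q : ℝ × ({c : ι // c ≠ a} → ℝ) => insertCoord a q.1 q.2) (u, y) := by
  rw [differentiableAt_pi]
  intro c
  by_cases h : c = a
  · subst h; simp
  · simp only [insertCoord, h, dif_neg, not_false_eq_true]; fun_prop

theorem differentiable_insertCoord [Fintype ι] :
    Differentiable ℝ (fun q : ℝ × ({c : ι // c ≠ a} → ℝ) => insertCoord a q.1 q.2) :=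
  fun q => differentiableAt_insertCoord q.1 q.2

/-- Splitting off the coordinate `a` preserves Lebesgue measure. -/
theorem measurePreserving_insertCoord [Fintype ι] :
    MeasurePreserving (fun q : ℝ × ({c : ι // c ≠ a} → ℝ) => insertCoord a q.1 q.2)
      (volume.prod volume) volume := by
  have h1 : MeasurePreserving
      (MeasurableEquiv.piEquivPiSubtypeProd (fun _ : ι => ℝ) (fun c => c = a)).symm
      (volume : Measure (({c : ι // c = a} → ℝ) × ({c : ι // c ≠ a} → ℝ))) volume := by
    convert (volume_preserving_piEquivPiSubtypeProd (fun _ : ι => ℝ) (fun c => c = a)).symm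
      <;> rfl
  have h2 : MeasurePreserving (MeasurableEquiv.funUnique {c : ι // c = a} ℝ).symm
      volume volume := by
    convert (volume_preserving_funUnique {c : ι // c = a} ℝ).symm
  have h3 : MeasurePreserving (Prod.map (MeasurableEquiv.funUnique {c : ι // c = a} ℝ).symm
      (id : ({c : ι // c ≠ a} → ℝ) → _)) (volume.prod volume) volume :=
    h2.prod (MeasurePreserving.id volume)
  have h4 := h1.comp h3
  convert h4 using 1
  funext q c
  by_cases h : c = a
  · subst h
    simp [MeasurableEquiv.piEquivPiSubtypeProd, Equiv.piEquivPiSubtypeProd, insertCoord,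
      MeasurableEquiv.funUnique]
  · simp [MeasurableEquiv.piEquivPiSubtypeProd, Equiv.piEquivPiSubtypeProd, insertCoord, h]

theorem hasDerivAt_comp_update [Fintype ι] {F : (ι → ℝ) → ℝ} {x : ι → ℝ}
    (hF : DifferentiableAt ℝ F x) (c : ι) :
    HasDerivAt (fun u : ℝ => F (Function.update x c u)) (fderiv ℝ F x (Pi.single c 1)) (x c) := by
  have h := hasDerivAt_update x c (x c)
  have hF' : HasFDerivAt F (fderiv ℝ F x) (Function.update x c (x c)) := by
    rw [Function.update_eq_self]; exact hF.hasFDerivAt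
  exact hF'.comp_hasDerivAt (x c) h

end Coordinates

/-! ### Regrouping independent variables -/

section Independence
variable {Ω α β γ : Type*} [MeasurableSpace Ω] {μ : Measure Ω} [IsProbabilityMeasure μ]
  [MeasurableSpace α] [MeasurableSpace β] [MeasurableSpace γ]

/-- The joint law is a threefold product measure, which may be reassociated. Meant for the leaf's
noise, the other noises and the past. -/
theorem IndepFun.prodMk_right_of_indepFun_prodMk {A : Ω → α} {B : Ω → β} {C : Ω → γ}
    (hA : Measurable A) (hB : Measurable B) (hC : Measurable C)
    (hAB : IndepFun A B μ) (hABC : IndepFun (fun ω => (A ω, B ω)) C μ) :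
    IndepFun A (fun ω => (B ω, C ω)) μ := by
  have hBC : IndepFun B C μ := hABC.comp measurable_snd measurable_id
  have := Measure.isProbabilityMeasure_map (μ := μ) hA.aemeasurable
  have := Measure.isProbabilityMeasure_map (μ := μ) hB.aemeasurable
  have := Measure.isProbabilityMeasure_map (μ := μ) hC.aemeasurable
  rw [indepFun_iff_map_prod_eq_prod_map_map hA.aemeasurable (hB.prodMk hC).aemeasurable,
    (indepFun_iff_map_prod_eq_prod_map_map hB.aemeasurable hC.aemeasurable).1 hBC,
    ← Measure.prodAssoc_prod,
    ← (indepFun_iff_map_prod_eq_prod_map_map hA.aemeasurable hB.aemeasurable).1 hAB,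
    ← (indepFun_iff_map_prod_eq_prod_map_map (hA.prodMk hB).aemeasurable hC.aemeasurable).1 hABC,
    Measure.map_map MeasurableEquiv.prodAssoc.measurable ((hA.prodMk hB).prodMk hC)]
  rfl

end Independence

/-! ### Variance gained from independent Gaussian noise -/

section Variance
variable {Ω : Type*} [MeasurableSpace Ω] {μ : Measure Ω} [IsProbabilityMeasure μ]

/-- The mean minimises the second moment. An arbitrary `c` is allowed because the mean of the
noisier variable may be the default `0` of a non-integrable function. -/
theorem evariance_le_lintegral_sub_const {X : Ω → ℝ} (hX : MemLp X 2 μ) (c : ℝ) :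
    evariance X μ ≤ ∫⁻ ω, ENNReal.ofReal ((X ω - c) ^ 2) ∂μ := by
  have hc : MemLp (fun ω => X ω - c) 2 μ := hX.sub (memLp_const c)
  rw [← ofReal_variance hX, ← variance_sub_const hX.1 c,
    ← ofReal_integral_eq_lintegral_ofReal hc.integrable_sq
      (Filter.Eventually.of_forall fun _ => sq_nonneg _)]
  exact ENNReal.ofReal_le_ofReal (variance_le_expectation_sq hc.1)

/-- The cross term integrates to zero since the Gaussian is centred. -/
theorem lintegral_gaussianReal_affine_sq {v : ℝ≥0} (A B : ℝ) :
    ∫⁻ u, ENNReal.ofReal ((A + u * B) ^ 2) ∂(gaussianReal 0 v)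
      = ENNReal.ofReal (A ^ 2) + ENNReal.ofReal (v * B ^ 2) := by
  have hid : MemLp (fun u : ℝ => u) 2 (gaussianReal 0 v) := memLp_id_gaussianReal 2
  have hL : MemLp (fun u : ℝ => A + u * B) 2 (gaussianReal 0 v) :=
    (memLp_const A).add (hid.mul_const B)
  have hvar : Var[fun u : ℝ => A + u * B; gaussianReal 0 v] = v * B ^ 2 := by
    rw [variance_const_add (hid.mul_const B).1, variance_mul_const]
    have := variance_id_gaussianReal (μ := 0) (v := v)
    rw [show (fun u : ℝ => u) = id from rfl, this]
  have hmean : ∫ u, A + u * B ∂(gaussianReal 0 v) = A := by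
    rw [integral_add (integrable_const A) ((hid.mul_const B).integrable (by norm_num)),
      integral_mul_const, integral_id_gaussianReal]
    simp
  rw [← ofReal_integral_eq_lintegral_ofReal hL.integrable_sq
      (Filter.Eventually.of_forall fun _ => sq_nonneg _),
    ← ENNReal.ofReal_add (sq_nonneg _) (by positivity)]
  congr 1
  have := variance_eq_sub hL
  rw [hvar, hmean] at this
  simp only [Pi.pow_apply] at this
  linarith

/-- If `Z` is centred Gaussian and independent of `Y`, then adding `Z * B(Y)` to `A(Y)`
increases the variance, strictly unless `B(Y)` vanishes almost surely. -/
theorem evariance_lt_evariance_add_gaussian_mul {𝓨 : Type*} [MeasurableSpace 𝓨]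
    {Y : Ω → 𝓨} {Z : Ω → ℝ} {v : ℝ≥0} (hv : 0 < v) (hY : Measurable Y) (hZ : Measurable Z)
    (hZlaw : μ.map Z = gaussianReal 0 v) (hind : IndepFun Z Y μ) {A B : 𝓨 → ℝ}
    (hA : Measurable A) (hB : Measurable B) (hfin : evariance (fun ω => A (Y ω)) μ < ∞)
    (hB0 : μ {ω | B (Y ω) ≠ 0} ≠ 0) :
    evariance (fun ω => A (Y ω)) μ < evariance (fun ω => A (Y ω) + Z ω * B (Y ω)) μ := by
  have hAL : MemLp (fun ω => A (Y ω)) 2 μ :=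
    (evariance_lt_top_iff_memLp (hA.comp hY).aestronglyMeasurable).1 hfin
  set c := μ[fun ω => A (Y ω) + Z ω * B (Y ω)] with hc
  have := Measure.isProbabilityMeasure_map (μ := μ) hY.aemeasurable
  have hmap := (indepFun_iff_map_prod_eq_prod_map_map hZ.aemeasurable hY.aemeasurable).1 hind
  -- Tonelli, integrating the noise first with `Y` frozen; nonnegativity makes integrability of
  -- `B(Y)` unnecessary.
  have key : evariance (fun ω => A (Y ω) + Z ω * B (Y ω)) μ
      = (∫⁻ ω, ENNReal.ofReal ((A (Y ω) - c) ^ 2) ∂μ)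
        + ∫⁻ ω, ENNReal.ofReal (v * B (Y ω) ^ 2) ∂μ := by
    rw [evariance_eq_lintegral_ofReal, ← hc]
    have h1 : Measurable fun q : ℝ × 𝓨 => ENNReal.ofReal ((A q.2 + q.1 * B q.2 - c) ^ 2) := by
      fun_prop
    have h2 : Measurable fun y : 𝓨 => ENNReal.ofReal ((A y - c) ^ 2) := by fun_prop
    have h3 : Measurable fun y : 𝓨 => ENNReal.ofReal (v * B y ^ 2) := by fun_prop
    rw [← lintegral_map (g := Y) h2 hY, ← lintegral_map (g := Y) h3 hY, ← lintegral_add_left h2,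
      ← lintegral_map (g := fun ω => (Z ω, Y ω)) h1 (hZ.prodMk hY), hmap, hZlaw,
      lintegral_prod_symm' _ h1]
    refine lintegral_congr fun y => ?_
    rw [← lintegral_gaussianReal_affine_sq]
    refine lintegral_congr fun u => ?_
    ring_nf
  rw [key]
  have hpos : (∫⁻ ω, ENNReal.ofReal (v * B (Y ω) ^ 2) ∂μ) ≠ 0 := by
    have hm : Measurable fun ω => ENNReal.ofReal (v * B (Y ω) ^ 2) := by fun_prop
    rw [Ne, lintegral_eq_zero_iff hm]
    intro h0
    apply hB0
    have h1 : ∀ᵐ ω ∂μ, B (Y ω) = 0 := by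
      filter_upwards [h0] with ω hω
      by_contra hne
      have h2 : (0 : ℝ) < v * B (Y ω) ^ 2 := mul_pos hv (by positivity)
      exact (ENNReal.ofReal_pos.2 h2).ne' hω
    exact h1
  calc evariance (fun ω => A (Y ω)) μ
      < evariance (fun ω => A (Y ω)) μ + ∫⁻ ω, ENNReal.ofReal (v * B (Y ω) ^ 2) ∂μ :=
        ENNReal.lt_add_right hfin.ne hpos
    _ ≤ _ := by gcongr; exact evariance_le_lintegral_sub_const hAL c

end Variance

/-! ### Factorisation of the joint density -/

section Factorization
variable {Ω : Type*} [MeasurableSpace Ω] {μ : Measure Ω} [IsProbabilityMeasure μ]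
  {ι : Type*} [Fintype ι] [DecidableEq ι] {a : ι}

/-- If `V` has a density `g` and `V a` is a function `h` of the other coordinates plus independent
Gaussian noise, then `g` is almost everywhere the product of a function of the other coordinates
and a Gaussian density centred at `h`. -/
theorem ae_eq_mul_gaussianPDF_of_indepFun {V : Ω → ι → ℝ} {Z : Ω → ℝ}
    {v : ℝ≥0} (hv : 0 < v) (hV : Measurable V) (hZ : Measurable Z)
    {g : (ι → ℝ) → ℝ} (hg : Continuous g)
    (hlaw : μ.map V = volume.withDensity fun x => ENNReal.ofReal (g x))
    (hZlaw : μ.map Z = gaussianReal 0 v)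
    (hind : IndepFun Z (fun ω (c : {c : ι // c ≠ a}) => V ω c) μ)
    {h : ({c : ι // c ≠ a} → ℝ) → ℝ} (hh : Measurable h)
    (heq : ∀ᵐ ω ∂μ, V ω a = h (fun c => V ω c) + Z ω) :
    ∃ m : ({c : ι // c ≠ a} → ℝ) → ℝ≥0∞,
      ∀ᵐ q : ℝ × ({c : ι // c ≠ a} → ℝ), ENNReal.ofReal (g (insertCoord a q.1 q.2))
        = gaussianPDF (h q.2) v q.1 * m q.2 := by
  set Y : Ω → {c : ι // c ≠ a} → ℝ := fun ω c => V ω c with hYdef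
  have hY : Measurable Y := by fun_prop
  have hI := measurePreserving_insertCoord (a := a)
  have hG : Measurable fun x => ENNReal.ofReal (g x) := hg.measurable.ennreal_ofReal
  have hGI : Measurable fun q : ℝ × ({c : ι // c ≠ a} → ℝ) =>
      ENNReal.ofReal (g (insertCoord a q.1 q.2)) := hG.comp hI.measurable
  set ν := μ.map Y with hν
  have hνprob : IsProbabilityMeasure ν := Measure.isProbabilityMeasure_map hY.aemeasurable
  have h1 : μ.map (fun ω => (V ω a, Y ω)) = (volume.prod volume).withDensity
      fun q => ENNReal.ofReal (g (insertCoord a q.1 q.2)) := by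
    refine Measure.ext_of_lintegral _ fun f hf => ?_
    have hf' : Measurable fun x : ι → ℝ => f (x a, fun c => x c) := by fun_prop
    rw [lintegral_map hf (by fun_prop), ← lintegral_map (g := V) hf' hV, hlaw,
      lintegral_withDensity_eq_lintegral_mul _ hG hf', ← hI.lintegral_comp (hG.mul hf'),
      lintegral_withDensity_eq_lintegral_mul _ hGI hf]
    refine lintegral_congr fun q => ?_
    simp
  -- A null set `s` gives a null cylinder over `s`, so `Y` has a density `m`.
  have hac : ν ≪ volume := by
    refine Measure.AbsolutelyContinuous.mk fun s hs hs0 => ?_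
    have h2 : (μ.map (fun ω => (V ω a, Y ω))) (Set.univ ×ˢ s) = 0 := by
      rw [h1]
      apply withDensity_absolutelyContinuous
      simp [hs0]
    rw [Measure.map_apply (by fun_prop) (MeasurableSet.univ.prod hs)] at h2
    rw [hν, Measure.map_apply hY hs]
    simpa [Set.preimage] using h2
  set m := ν.rnDeriv volume
  have hmm : Measurable m := Measure.measurable_rnDeriv _ _
  have hνd : volume.withDensity m = ν := Measure.withDensity_rnDeriv_eq _ _ hac
  refine ⟨m, ?_⟩
  have hφ : Measurable fun q : ℝ × ({c : ι // c ≠ a} → ℝ) =>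
      gaussianPDF (h q.2) v q.1 * m q.2 := by
    have := measurable_uncurry_gaussianPDF.comp (f := fun q : ℝ × ({c : ι // c ≠ a} → ℝ) =>
      (h q.2, v, q.1)) (by fun_prop)
    exact Measurable.mul this (by fun_prop)
  have h2 : μ.map (fun ω => (V ω a, Y ω)) = (volume.prod volume).withDensity
      fun q => gaussianPDF (h q.2) v q.1 * m q.2 := by
    refine Measure.ext_of_lintegral _ fun f hf => ?_
    have hf' : Measurable fun q : ℝ × ({c : ι // c ≠ a} → ℝ) => f (h q.2 + q.1, q.2) := by
      fun_prop
    rw [lintegral_map hf (by fun_prop), lintegral_withDensity_eq_lintegral_mul _ hφ hf,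
      lintegral_prod_symm' _ (hφ.mul hf)]
    have h3 : ∫⁻ ω, f (V ω a, Y ω) ∂μ = ∫⁻ ω, f (h (Y ω) + Z ω, Y ω) ∂μ := by
      refine lintegral_congr_ae ?_
      filter_upwards [heq] with ω hω
      rw [hω]
    rw [h3, ← lintegral_map (g := fun ω => (Z ω, Y ω)) hf' (hZ.prodMk hY),
      (indepFun_iff_map_prod_eq_prod_map_map hZ.aemeasurable hY.aemeasurable).1 hind,
      lintegral_prod_symm' _ hf', ← hν, ← hνd,
      lintegral_withDensity_eq_lintegral_mul _ hmm (by fun_prop)]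
    refine lintegral_congr fun y => ?_
    have hfy : Measurable fun u => f (h y + u, y) := by fun_prop
    rw [Pi.mul_apply, hZlaw, gaussianReal_of_var_ne_zero _ hv.ne',
      lintegral_withDensity_eq_lintegral_mul _ (measurable_gaussianPDF 0 v) hfy,
      ← lintegral_const_mul _ ((measurable_gaussianPDF 0 v).mul hfy)]
    -- Translation by `h y` turns the noise variable into the coordinate `a`.
    refine Eq.trans ?_ (lintegral_add_left_eq_self _ (h y))
    refine lintegral_congr fun u => ?_
    simp only [Pi.mul_apply, gaussianPDF]
    have : gaussianPDFReal (h y) v (h y + u) = gaussianPDFReal 0 v u := by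
      simp [gaussianPDFReal]
    rw [this]
    ring
  have h3 := h1.symm.trans h2
  exact (withDensity_eq_iff_of_sigmaFinite hGI.aemeasurable
    hφ.aemeasurable).1 h3

/-- If `V` has a positive continuous density `g` and `V a` is a continuous function `h` of the other
coordinates plus independent Gaussian noise, then `g` is the product of the marginal density and
a Gaussian density centred at `h`. -/
theorem eq_mul_gaussianPDFReal_of_indepFun {V : Ω → ι → ℝ} {Z : Ω → ℝ}
    {v : ℝ≥0} (hv : 0 < v) (hV : Measurable V) (hZ : Measurable Z)
    {g : (ι → ℝ) → ℝ} (hg : Continuous g) (hpos : ∀ x, 0 < g x)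
    (hlaw : μ.map V = volume.withDensity fun x => ENNReal.ofReal (g x))
    (hZlaw : μ.map Z = gaussianReal 0 v)
    (hind : IndepFun Z (fun ω (c : {c : ι // c ≠ a}) => V ω c) μ)
    {h : ({c : ι // c ≠ a} → ℝ) → ℝ} (hh : Continuous h)
    (heq : ∀ᵐ ω ∂μ, V ω a = h (fun c => V ω c) + Z ω)
    (u : ℝ) (y : {c : ι // c ≠ a} → ℝ) :
    g (insertCoord a u y) = marginalDensity g a y * gaussianPDFReal (h y) v u := by
  obtain ⟨m, hae⟩ := ae_eq_mul_gaussianPDF_of_indepFun hv hV hZ hg hlaw hZlaw hind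
    hh.measurable heq
  have hφ : Continuous fun q : ℝ × ({c : ι // c ≠ a} → ℝ) => gaussianPDFReal (h q.2) v q.1 := by
    unfold gaussianPDFReal; fun_prop
  have hφpos : ∀ b u, 0 < gaussianPDFReal b v u := fun b u => gaussianPDFReal_pos b v u hv.ne'
  have hins := (differentiable_insertCoord (a := a)).continuous
  have hae' : ∀ᵐ q : ℝ × ({c : ι // c ≠ a} → ℝ),
      g (insertCoord a q.1 q.2) = (m q.2).toReal * gaussianPDFReal (h q.2) v q.1 := by
    filter_upwards [hae] with q hq
    have := congrArg ENNReal.toReal hq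
    rwa [ENNReal.toReal_ofReal (hpos _).le, ENNReal.toReal_mul, toReal_gaussianPDF,
      mul_comm] at this
  -- By Fubini some slice `u₀` satisfies the identity for almost every `y`; dividing by the Gaussian
  -- there yields a continuous version `M` of `m`.
  obtain ⟨u₀, hu₀⟩ := (Measure.ae_ae_of_ae_prod hae').exists
  set M : ({c : ι // c ≠ a} → ℝ) → ℝ := fun y =>
    g (insertCoord a u₀ y) / gaussianPDFReal (h y) v u₀ with hM
  have hMc : Continuous M := by
    refine Continuous.div ?_ ?_ fun y => (hφpos _ _).ne'
    · exact hg.comp (hins.comp (by fun_prop : Continuous fun y : {c : ι // c ≠ a} → ℝ => (u₀, y)))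
    · exact hφ.comp (by fun_prop : Continuous fun y : {c : ι // c ≠ a} → ℝ => (u₀, y))
  have hMm : ∀ᵐ q : ℝ × ({c : ι // c ≠ a} → ℝ), M q.2 = (m q.2).toReal := by
    refine Measure.quasiMeasurePreserving_snd.ae (p := fun y => M y = (m y).toReal) ?_
    filter_upwards [hu₀] with y hy
    rw [hM]
    simp only
    rw [hy, mul_div_assoc, div_self (hφpos _ _).ne', mul_one]
  -- Continuous functions that agree almost everywhere for Lebesgue measure agree everywhere.
  have hall : (fun q : ℝ × ({c : ι // c ≠ a} → ℝ) => g (insertCoord a q.1 q.2))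
      = fun q => M q.2 * gaussianPDFReal (h q.2) v q.1 := by
    refine (Continuous.ae_eq_iff_eq volume (hg.comp hins)
      ((hMc.comp continuous_snd).mul hφ)).1 ?_
    filter_upwards [hae', hMm] with q hq1 hq2
    simp only [Function.comp_apply, Pi.mul_apply]
    rw [hq1, hq2]
  have hall' : ∀ u y, g (insertCoord a u y) = M y * gaussianPDFReal (h y) v u := fun u y =>
    congrFun hall (u, y)
  -- Integrating out `u` identifies `M` with the marginal density.
  rw [hall', marginalDensity]
  simp only [hall']
  rw [integral_const_mul, integral_gaussianPDFReal_eq_one _ hv.ne', mul_one]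

end Factorization

/-! ### The score identity -/

section Score
variable {ι : Type*} [DecidableEq ι] {a : ι}

theorem marginalDensity_pos {g : (ι → ℝ) → ℝ} (hpos : ∀ x, 0 < g x)
    {v : ℝ≥0} (hv : 0 < v) {h : ({c : ι // c ≠ a} → ℝ) → ℝ}
    (hfac : ∀ u y, g (insertCoord a u y) = marginalDensity g a y * gaussianPDFReal (h y) v u)
    (y : {c : ι // c ≠ a} → ℝ) : 0 < marginalDensity g a y := by
  have := hfac 0 y ▸ hpos (insertCoord a 0 y)
  exact (pos_iff_pos_of_mul_pos this).2 (gaussianPDFReal_pos _ _ _ hv.ne')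

variable [Fintype ι]

/-- Differentiation under the integral is avoided: the marginal is the slice of `g` at `u = 0`
divided by a positive Gaussian factor. -/
theorem differentiable_marginalDensity {g : (ι → ℝ) → ℝ} (hg : Differentiable ℝ g)
    {v : ℝ≥0} (hv : 0 < v) {h : ({c : ι // c ≠ a} → ℝ) → ℝ} (hh : Differentiable ℝ h)
    (hfac : ∀ u y, g (insertCoord a u y) = marginalDensity g a y * gaussianPDFReal (h y) v u) :
    Differentiable ℝ (marginalDensity g a) := by
  have hφpos : ∀ y, 0 < gaussianPDFReal (h y) v 0 := fun y => gaussianPDFReal_pos _ v 0 hv.ne'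
  have : marginalDensity g a = fun y => g (insertCoord a 0 y) / gaussianPDFReal (h y) v 0 := by
    funext y
    rw [hfac, mul_div_assoc, div_self (hφpos y).ne', mul_one]
  rw [this]
  have hφ : Differentiable ℝ fun y => gaussianPDFReal (h y) v 0 := by
    unfold gaussianPDFReal; fun_prop
  have hins : Differentiable ℝ fun y : {c : ι // c ≠ a} → ℝ => insertCoord a 0 y :=
    (differentiable_insertCoord (a := a)).comp
      (by fun_prop : Differentiable ℝ fun y : {c : ι // c ≠ a} → ℝ => ((0 : ℝ), y))
  simp only [div_eq_mul_inv]
  exact (hg.comp hins).mul (hφ.inv fun y => (hφpos y).ne')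

/-- The logarithm of the Gaussian factor is a constant minus `(x a - h)² / (2v)`; its derivative in
`c` gives the second term. -/
theorem partialScore_eq_add_of_eq_mul_gaussianPDFReal {g : (ι → ℝ) → ℝ} (hpos : ∀ x, 0 < g x)
    (hg : Differentiable ℝ g) {v : ℝ≥0} (hv : 0 < v)
    {h : ({c : ι // c ≠ a} → ℝ) → ℝ} (hh : Differentiable ℝ h)
    (hfac : ∀ u y, g (insertCoord a u y) = marginalDensity g a y * gaussianPDFReal (h y) v u)
    (c : {c : ι // c ≠ a}) (x : ι → ℝ) :
    partialScore g c x = partialScore (marginalDensity g a) c (fun i => x i)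
      + (x a - h (fun i => x i)) * (partialDeriv h c (fun i => x i) / v) := by
  set y : {c : ι // c ≠ a} → ℝ := fun i => x i with hy
  have hφpos : ∀ b u, 0 < gaussianPDFReal b v u := fun b u => gaussianPDFReal_pos b v u hv.ne'
  have hmpos := marginalDensity_pos hpos hv hfac
  have hmd := differentiable_marginalDensity hg hv hh hfac
  have hv0 : (v : ℝ) ≠ 0 := by exact_mod_cast hv.ne'
  have hupd : ∀ u : ℝ, Function.update x (c : ι) u = insertCoord a (x a) (Function.update y c u) := by
    intro u
    funext i
    by_cases hi : i = a
    · subst hi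
      rw [insertCoord_self, Function.update_of_ne c.2.symm]
    · obtain ⟨i', rfl⟩ : ∃ i' : {c : ι // c ≠ a}, (i' : ι) = i := ⟨⟨i, hi⟩, rfl⟩
      rw [insertCoord_coe]
      by_cases hc : i' = c
      · subst hc; simp
      · rw [Function.update_of_ne hc, Function.update_of_ne (fun h => hc (Subtype.ext h))]
  have hlog : ∀ u : ℝ, Real.log (g (Function.update x (c : ι) u))
      = Real.log (marginalDensity g a (Function.update y c u))
        + (Real.log (√(2 * Real.pi * v))⁻¹
          + -(x a - h (Function.update y c u)) ^ 2 / (2 * v)) := by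
    intro u
    have hs : (√(2 * Real.pi * v))⁻¹ ≠ 0 := by
      have : (0 : ℝ) < v := hv
      positivity
    rw [hupd, hfac, Real.log_mul (hmpos _).ne' (hφpos _ _).ne', gaussianPDFReal,
      Real.log_mul hs (Real.exp_ne_zero _), Real.log_exp]
  have hhd := hasDerivAt_comp_update (hh y) c
  have hmlog := hasDerivAt_comp_update ((hmd y).log (hmpos y).ne') c
  have hyc : Function.update y c (x c) = y := Function.update_eq_self c y
  have hq := ((((hhd.const_sub (x a)).pow 2).neg).div_const (2 * (v : ℝ))).const_add
    (Real.log (√(2 * Real.pi * v))⁻¹)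
  have hsum := hmlog.add hq
  unfold partialScore
  unfold partialDeriv
  have e1 := hmlog.deriv
  have e2 := hhd.deriv
  have e3 := hsum.deriv
  rw [e1, e2, funext hlog]
  refine (Eq.trans ?_ e3).trans ?_
  · rfl
  · rw [show y c = x c from rfl, hyc]
    field_simp
    ring

theorem measurable_partialDeriv {F : (ι → ℝ) → ℝ} (hF : Differentiable ℝ F) (c : ι) :
    Measurable (partialDeriv F c) := by
  have : partialDeriv F c = fun x => fderiv ℝ F x (Pi.single c 1) :=
    funext fun x => (hasDerivAt_comp_update (hF x) c).deriv
  rw [this]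
  exact measurable_fderiv_apply_const ℝ F _

theorem continuous_partialDeriv {F : (ι → ℝ) → ℝ} (hF : ContDiff ℝ 1 F) (c : ι) :
    Continuous (partialDeriv F c) := by
  have : partialDeriv F c = fun x => fderiv ℝ F x (Pi.single c 1) :=
    funext fun x => (hasDerivAt_comp_update (hF.differentiable one_ne_zero x) c).deriv
  rw [this]
  exact (hF.continuous_fderiv one_ne_zero).clm_apply continuous_const

end Score

/-! ### Independence of the leaf's noise -/

namespace SVARModel
variable {d p : ℕ}

section Noise
variable {Ω : Type*} [MeasurableSpace Ω] {μ : Measure Ω}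
  {M : SVARModel d p} {T : ℕ} {X z : ℕ → Fin d → Ω → ℝ}

/-- At time `t`, every feature other than the leaf `l` is almost surely a measurable function of
the noise of the features other than `l` and of the past. -/
theorem Generates.exists_ae_eq_comp_noise_past (hX : M.Generates T μ X z)
    (hlink : ∀ j, Measurable (M.link j)) {t : ℕ} (hpt : p < t) (htT : t ≤ T)
    {l : Fin d} (hl : M.IsLeaf l) (j : Fin d) (hj : j ≠ l) :
    ∃ F : ({i : Fin d // i ≠ l} → ℝ) × (Set.Ico 1 t → Fin d → ℝ) → ℝ, Measurable F ∧
      ∀ᵐ ω ∂μ, X t j ω = F (fun i => z t i ω, fun r i => X r i ω) := by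
  have hirr : Std.Irrefl (Relation.TransGen fun i j : Fin d => ((0, i) : LagNode d p) ∈ M.pa j) :=
    ⟨M.acyclic⟩
  have hwf := Finite.wellFounded_of_trans_of_irrefl
    (Relation.TransGen fun i j : Fin d => ((0, i) : LagNode d p) ∈ M.pa j)
  -- Acyclicity on a finite set makes the ancestor relation well-founded.
  induction j using hwf.induction with
  | _ j ih =>
    have hpar : ∀ c : M.pa j, ∃ F : ({i : Fin d // i ≠ l} → ℝ) × (Set.Ico 1 t → Fin d → ℝ) → ℝ,
        Measurable F ∧ ∀ᵐ ω ∂μ, X (t - ((c : LagNode d p).1 : ℕ)) (c : LagNode d p).2 ω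
          = F (fun i => z t i ω, fun r i => X r i ω) := by
      rintro ⟨⟨k, i⟩, hc⟩
      by_cases hk : k = 0
      · subst hk
        exact ih i (Relation.TransGen.single hc) fun hil => hl j (hil ▸ hc)
      · have hk0 : (k : ℕ) ≠ 0 := fun h => hk (Fin.ext h)
        -- `k ≤ p < t` prevents truncated subtraction from reaching `0`, and `k ≠ 0` places the
        -- parent strictly in the past.
        have hr : t - (k : ℕ) ∈ Set.Ico 1 t := by
          have := k.2
          exact ⟨by omega, by omega⟩
        refine ⟨fun w => w.2 ⟨t - (k : ℕ), hr⟩ i, by fun_prop,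
          Filter.Eventually.of_forall fun _ => rfl⟩
    choose F hFm hF using hpar
    refine ⟨fun w => M.link j (fun c => F c w) + w.1 ⟨j, hj⟩, ?_, ?_⟩
    · have := hlink j
      fun_prop
    · filter_upwards [hX.equation t ⟨hpt, htT⟩, ae_all_iff.2 hF] with ω hω hFω
      rw [hω j]
      simp only [hFω]

theorem Generates.indepFun_noise_stackedVectorWithout [IsProbabilityMeasure μ]
    (hX : M.Generates T μ X z)
    (hlink : ∀ j, Measurable (M.link j)) {t : ℕ} (hpt : p < t) (htT : t ≤ T)
    {l : Fin d} (hl : M.IsLeaf l) :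
    IndepFun (z t l) (stackedVectorWithout p X t l) μ := by
  have ht : t ∈ Set.Ioc p T := ⟨hpt, htT⟩
  have hz : ∀ i, Measurable (z t i) := hX.measurable_noise t ht
  have hpast : Measurable fun ω (r : Set.Ico 1 t) (i : Fin d) => X r i ω :=
    measurable_pi_lambda _ fun r => measurable_pi_lambda _ fun i =>
      hX.measurable_process r ⟨r.2.1, r.2.2.le.trans htT⟩ i
  have hAB : IndepFun (z t l) (fun ω (i : {i : Fin d // i ≠ l}) => z t i ω) μ := by
    have h := (hX.noise_indep t ht).indepFun_finset {l} {l}ᶜ disjoint_compl_right hz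
    exact h.comp
      (φ := fun x : ({l} : Finset (Fin d)) → ℝ => x ⟨l, Finset.mem_singleton_self l⟩)
      (ψ := fun (x : ({l}ᶜ : Finset (Fin d)) → ℝ) (i : {i : Fin d // i ≠ l}) =>
        x ⟨i, by simpa using i.2⟩)
      (by fun_prop) (by fun_prop)
  have hABC : IndepFun (fun ω => (z t l ω, fun i : {i : Fin d // i ≠ l} => z t i ω))
      (fun ω (r : Set.Ico 1 t) (i : Fin d) => X r i ω) μ :=
    (hX.noise_indep_past t ht).comp
      (φ := fun w : Fin d → ℝ => (w l, fun i : {i : Fin d // i ≠ l} => w i)) (by fun_prop)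
      measurable_id
  have hind := IndepFun.prodMk_right_of_indepFun_prodMk (hz l) (by fun_prop) hpast hAB hABC
  have hY : ∀ c : {c : LagNode d p // c ≠ (0, l)},
      ∃ F : ({i : Fin d // i ≠ l} → ℝ) × (Set.Ico 1 t → Fin d → ℝ) → ℝ, Measurable F ∧
        ∀ᵐ ω ∂μ, stackedVectorWithout p X t l ω c
          = F (fun i => z t i ω, fun r i => X r i ω) := by
    rintro ⟨⟨k, i⟩, hc⟩
    by_cases hk : k = 0
    · subst hk
      exact hX.exists_ae_eq_comp_noise_past hlink hpt htT hl i fun h => hc (h ▸ rfl)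
    · have hk0 : (k : ℕ) ≠ 0 := fun h => hk (Fin.ext h)
      have hr : t - (k : ℕ) ∈ Set.Ico 1 t := by
        have := k.2
        exact ⟨by omega, by omega⟩
      exact ⟨fun w => w.2 ⟨t - (k : ℕ), hr⟩ i, by fun_prop,
          Filter.Eventually.of_forall fun _ => rfl⟩
  choose F hFm hF using hY
  refine (hind.comp (φ := id) (ψ := fun w c => F c w) measurable_id
    (measurable_pi_lambda _ hFm)).congr Filter.EventuallyEq.rfl ?_
  filter_upwards [ae_all_iff.2 hF] with ω hω
  funext c
  exact (hω c).symm

end Noise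

/-! ### The leaf's link function -/

/-- The link function of the leaf `l` as a function of all the variables other than `l`. -/
noncomputable def leafLink (M : SVARModel d p) {l : Fin d} (hl : M.IsLeaf l)
    (y : {c : LagNode d p // c ≠ (0, l)} → ℝ) : ℝ :=
  M.link l fun c : M.pa l => y ⟨c, fun h => hl l (h ▸ c.2)⟩

theorem contDiff_leafLink (M : SVARModel d p) (hM : M.RegularLinks) {l : Fin d}
    (hl : M.IsLeaf l) : ContDiff ℝ (⊤ : ℕ∞) (M.leafLink hl) := by
  have := hM.smooth l
  unfold leafLink
  fun_prop

theorem partialDeriv_leafLink_of_mem (M : SVARModel d p) {l : Fin d} (hl : M.IsLeaf l)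
    (c : {c : LagNode d p // c ≠ (0, l)}) (hc : (c : LagNode d p) ∈ M.pa l)
    (y : {c : LagNode d p // c ≠ (0, l)} → ℝ) :
    partialDeriv (M.leafLink hl) c y = partialDeriv (M.link l) ⟨c, hc⟩
      (fun c : M.pa l => y ⟨c, fun h => hl l (h ▸ c.2)⟩) := by
  unfold partialDeriv leafLink
  congr 1
  funext u
  congr 1
  funext b
  by_cases hb : (b : LagNode d p) = c
  · obtain rfl : b = ⟨c, hc⟩ := Subtype.ext hb
    simp
  · rw [Function.update_of_ne fun h => hb (congrArg Subtype.val h),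
      Function.update_of_ne fun h => hb (congrArg Subtype.val h)]

theorem partialDeriv_leafLink_of_notMem (M : SVARModel d p) {l : Fin d} (hl : M.IsLeaf l)
    (c : {c : LagNode d p // c ≠ (0, l)}) (hc : (c : LagNode d p) ∉ M.pa l)
    (y : {c : LagNode d p // c ≠ (0, l)} → ℝ) :
    partialDeriv (M.leafLink hl) c y = 0 := by
  unfold partialDeriv
  have : (fun u : ℝ => M.leafLink hl (Function.update y c u)) = fun _ => M.leafLink hl y := by
    funext u
    unfold leafLink
    congr 1
    funext b
    exact Function.update_of_ne (fun h => hc (by rw [← h]; exact b.2)) _ _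
  rw [this, deriv_const]

theorem exists_partialDeriv_leafLink_ne_zero (M : SVARModel d p) (hM : M.RegularLinks)
    {l : Fin d} (hl : M.IsLeaf l)
    (c : {c : LagNode d p // c ≠ (0, l)}) (hc : (c : LagNode d p) ∈ M.pa l) :
    ∃ y, partialDeriv (M.leafLink hl) c y ≠ 0 := by
  obtain ⟨x, hx⟩ := hM.partialDeriv_ne_zero l ⟨c, hc⟩
  -- The values at non-parents do not matter; `0` is a filler.
  refine ⟨fun b => if hb : (b : LagNode d p) ∈ M.pa l then x ⟨b, hb⟩ else 0, ?_⟩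
  rw [M.partialDeriv_leafLink_of_mem hl c hc]
  simpa using hx

end SVARModel

/-! ### The variance criterion -/

theorem mainTheorem1 {Ω : Type*} [MeasurableSpace Ω] (μ : Measure Ω) [IsProbabilityMeasure μ]
    {d p : ℕ} (M : SVARModel d p) (hM : M.RegularLinks)
    (T : ℕ) (X z : ℕ → Fin d → Ω → ℝ) (hX : M.Generates T μ X z)
    (t : ℕ) (hpt : p < t) (htT : t ≤ T)
    -- the joint density of the vector (X^{(t)}, …, X^{(t-p)})
    (g : (LagNode d p → ℝ) → ℝ)
    (hg_law : μ.map (stackedVector p X t) = volume.withDensity (fun x => ENNReal.ofReal (g x)))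
    (hg_pos : ∀ x, 0 < g x) (hg_diff : Differentiable ℝ g)
    (l : Fin d) (hl : M.IsLeaf l)
    (k : Fin (p + 1)) (j : Fin d) (hkj : ((k, j) : LagNode d p) ≠ (0, l))
    -- after the removal of l, the partial score has a finite variance
    (hfin : evariance (fun ω => partialScore (marginalDensity g (0, l)) ⟨(k, j), hkj⟩
      (stackedVectorWithout p X t l ω)) μ < ∞) :
    (k, j) ∈ M.pa l ↔
      evariance (fun ω => partialScore g (k, j) (stackedVector p X t ω)) μ >
        evariance (fun ω => partialScore (marginalDensity g (0, l)) ⟨(k, j), hkj⟩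
          (stackedVectorWithout p X t l ω)) μ := by
  have ht : t ∈ Set.Ioc p T := ⟨hpt, htT⟩
  set h := M.leafLink hl with hh
  have hhs : ContDiff ℝ (⊤ : ℕ∞) h := M.contDiff_leafLink hM hl
  have hhd : Differentiable ℝ h := hhs.differentiable (by simp)
  have hv := M.noiseVar_pos l
  have hV : Measurable (stackedVector p X t) := measurable_pi_lambda _ fun c =>
    hX.measurable_process _ ⟨by have := c.1.2; omega, by omega⟩ _
  have hY : Measurable (stackedVectorWithout p X t l) :=
    measurable_pi_lambda _ fun c => measurable_pi_iff.1 hV c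
  have hind := hX.indepFun_noise_stackedVectorWithout
    (fun j => (hM.smooth j).continuous.measurable) hpt htT hl
  have heq : ∀ᵐ ω ∂μ, stackedVector p X t ω (0, l)
      = h (stackedVectorWithout p X t l ω) + z t l ω := by
    filter_upwards [hX.equation t ht] with ω hω
    exact hω l
  have hfac := eq_mul_gaussianPDFReal_of_indepFun hv hV (hX.measurable_noise t ht l)
    hg_diff.continuous hg_pos hg_law (hX.noise_law t ht l) hind hhd.continuous heq
  have hpos := marginalDensity_pos hg_pos hv hfac
  have hscore : (fun ω => partialScore g (k, j) (stackedVector p X t ω)) =ᵐ[μ] fun ω =>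
      partialScore (marginalDensity g (0, l)) ⟨(k, j), hkj⟩ (stackedVectorWithout p X t l ω)
        + z t l ω * (partialDeriv h ⟨(k, j), hkj⟩ (stackedVectorWithout p X t l ω)
          / M.noiseVar l) := by
    filter_upwards [heq] with ω hω
    have := partialScore_eq_add_of_eq_mul_gaussianPDFReal hg_pos hg_diff hv hhd hfac
      ⟨(k, j), hkj⟩ (stackedVector p X t ω)
    refine this.trans ?_
    change _ + (stackedVector p X t ω (0, l) - h (stackedVectorWithout p X t l ω)) * _ = _
    rw [hω, add_sub_cancel_left]
    rfl
  rw [evariance_congr hscore]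
  constructor
  · intro hmem
    have hB := continuous_partialDeriv (hhs.of_le (by exact_mod_cast le_top)) ⟨(k, j), hkj⟩
    refine evariance_lt_evariance_add_gaussian_mul hv hY (hX.measurable_noise t ht l)
      (hX.noise_law t ht l) hind
      (A := partialScore (marginalDensity g (0, l)) ⟨(k, j), hkj⟩)
      (B := fun y => partialDeriv h ⟨(k, j), hkj⟩ y / M.noiseVar l) ?_ ?_ hfin ?_
    · exact measurable_partialDeriv
        ((differentiable_marginalDensity hg_diff hv hhd hfac).log fun y => (hpos y).ne') _
    · exact hB.measurable.div_const _
    · obtain ⟨y, hy⟩ := M.exists_partialDeriv_leafLink_ne_zero hM hl ⟨(k, j), hkj⟩ hmem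
      -- The nonvanishing set is pulled back to the full space, where the law has the positive
      -- density `g`.
      set U : Set (LagNode d p → ℝ) :=
        {x | partialDeriv h ⟨(k, j), hkj⟩ (fun c => x c) / M.noiseVar l ≠ 0} with hU
      have hUo : IsOpen U := by
        refine isOpen_ne_fun (Continuous.div_const ?_ _) continuous_const
        exact hB.comp (by fun_prop)
      have hUn : U.Nonempty := by
        refine ⟨insertCoord (0, l) 0 y, ?_⟩
        have hv0 : (M.noiseVar l : ℝ) ≠ 0 := by exact_mod_cast hv.ne'
        simpa [hU, hv0] using hy
      have hac : volume ≪ μ.map (stackedVector p X t) := by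
        rw [hg_law]
        exact withDensity_absolutelyContinuous'
          hg_diff.continuous.measurable.ennreal_ofReal.aemeasurable
          (Filter.Eventually.of_forall fun x => (ENNReal.ofReal_pos.2 (hg_pos x)).ne')
      intro h0
      refine hUo.measure_ne_zero volume hUn (hac ?_)
      rw [Measure.map_apply hV hUo.measurableSet]
      exact h0
  -- For a non-parent the noise term is zero, so the strict inequality would compare a quantity with
  -- itself.
  · intro hgt
    by_contra hmem
    have h0 := M.partialDeriv_leafLink_of_notMem hl ⟨(k, j), hkj⟩ hmem
    simp [hh, h0] at hgt
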